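/- Let $B=(B_s)_{s\ge 0}$ and $W=(W_s)_{s\ge 0}$ be two independent one-dimensional standard Brownian motions with continuous paths, $B_0=W_0=0$, on a probability space with probability $\mathbf P$, and let $\mathbf P^x(\cdot\,|W)$ denote the regular conditional probability given $W$ when $B$ is replaced by the Brownian motion $x+B$ started from $x$. Let $\beta>0$ and let $a,b,a_0,b_0,a',b'$ be real numbers with $$a<a_0\le b_0<b,\qquad a\le a'<b'\le b .$$ For $t>0$ put $$\overline X_t:=-\ln\inf_{x\in[a_0,b_0]}\mathbf P^{x}\big(\forall_{s\in[0,t]}\ \beta W_s+a\le B_s\le \beta W_s+b,\ \ \beta W_t+a'\le B_t\le \beta W_t+b'\ \big|\ W\big)\in[0,+\infty],$$ where $-\ln 0:=+\infty$. **Theorem 3.1.** For every $t>0$, $\overline X_t$ is (up to a null set) a random variable, and for all real $p>0$ and $q>1$, $$\lim_{n\to+\infty} n^p\,\mathbf P\big(\overline X_t\ge(\ln n)^q\big)=0 .$$ Consequently $\mathbf E\big(\overline X_t^{\,j}\big)<+\infty$ for every $j\in\mathbb N$. -/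

import Mathlib

open MeasureTheory ProbabilityTheory Filter Topology
open scoped NNReal ENNReal

/-- The Borel σ-algebra on the path space `C([0,∞), ℝ)` (topology of locally uniform
convergence). -/
instance instMeasurableSpacePathSpace : MeasurableSpace C(ℝ≥0, ℝ) := borel _

instance instBorelSpacePathSpace : BorelSpace C(ℝ≥0, ℝ) := ⟨rfl⟩

/-- The set of pairs of paths `(f, w)` such that the translated path `x + f` stays in the strip
`[β w_s + a, β w_s + b]` for all `s ∈ [0, t]` and lies in `[β w_t + a', β w_t + b']` at time `t`. -/
def stripEvent (β a b a' b' : ℝ) (t : ℝ≥0) (x : ℝ) : Set (C(ℝ≥0, ℝ) × C(ℝ≥0, ℝ)) :=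
  {p | (∀ s : ℝ≥0, s ≤ t → β * p.2 s + a ≤ x + p.1 s ∧ x + p.1 s ≤ β * p.2 s + b) ∧
    β * p.2 t + a' ≤ x + p.1 t ∧ x + p.1 t ≤ β * p.2 t + b'}

/-- The quenched probability
`P^x(∀ s ∈ [0,t], β W_s + a ≤ B_s ≤ β W_s + b, β W_t + a' ≤ B_t ≤ β W_t + b' | W)`
evaluated at `ω`. Here `B` starts from `0` under `P`, and `x + B` is the Brownian motion started
from `x`. The regular conditional distribution of `(B, W)` given `W` is the same for all `x`, so
that an infimum over uncountably many `x` makes sense. -/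
noncomputable def quenchedProb {Ω : Type*} [MeasurableSpace Ω] (P : Measure Ω)
    [IsProbabilityMeasure P] (B W : Ω → C(ℝ≥0, ℝ)) (β a b a' b' : ℝ) (t : ℝ≥0) (x : ℝ) (ω : Ω) :
    ℝ≥0∞ :=
  condDistrib (fun ω' => (B ω', W ω')) W P (W ω) (stripEvent β a b a' b' t x)

/-- `-ln inf_{x ∈ [a₀, b₀]} P^x(… | W)`, with values in the extended reals: it is `+∞` where the
infimum vanishes. -/
noncomputable def upperX {Ω : Type*} [MeasurableSpace Ω] (P : Measure Ω)
    [IsProbabilityMeasure P] (B W : Ω → C(ℝ≥0, ℝ)) (β a b a₀ b₀ a' b' : ℝ) (t : ℝ≥0) (ω : Ω) :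
    EReal :=
  -ENNReal.log (⨅ x ∈ Set.Icc a₀ b₀, quenchedProb P B W β a b a' b' t x ω)

/-- When `a₀ ≤ b₀`, the variable `upperX` is nonnegative, so that it loses nothing under
`EReal.toENNReal`. -/
theorem upperX_nonneg {Ω : Type*} [MeasurableSpace Ω] (P : Measure Ω)
    [IsProbabilityMeasure P] (B W : Ω → C(ℝ≥0, ℝ)) (β a b a₀ b₀ a' b' : ℝ) (t : ℝ≥0) (ω : Ω)
    (h : a₀ ≤ b₀) : 0 ≤ upperX P B W β a b a₀ b₀ a' b' t ω := by
  have h1 : (⨅ x ∈ Set.Icc a₀ b₀, quenchedProb P B W β a b a' b' t x ω) ≤ 1 :=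
    (iInf₂_le a₀ (Set.left_mem_Icc.2 h)).trans prob_le_one
  have h2 : ENNReal.log (⨅ x ∈ Set.Icc a₀ b₀, quenchedProb P B W β a b a' b' t x ω) ≤ 0 := by
    rw [← ENNReal.log_one]
    exact ENNReal.log_monotone h1
  unfold upperX
  rw [EReal.le_neg]
  simpa using h2

/-!
The variable `upperX` has an exponential tail: `P (upperX > K * m) ≤ C * exp (-c * m)` for all
natural `m`. This gives both the limit, because `exp (-c * (log n) ^ q)` decays faster than every
power of `n` when `q > 1`, and the finiteness of all moments.

By independence, the quenched probability at `W ω` is the probability, under the law of `B` alone,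
that `x + B` stays in the strip around the fixed path `β * W ω` (`quenchedProb_ae_eq`). Divide
`[0, t]` into `m` mesh intervals of length `h = t / m`, and call the path `w` of `W` tame
(`tamePaths`) if it oscillates by at most a small fixed `δ` on each mesh interval and if its squared
increments over the mesh sum to at most `8 * m * h`. The maximal inequality bounds the probability
that the first condition fails by `4 * m * exp (-δ ^ 2 * m / (2 * t))`, and a Chernoff bound for
the sum of squared Gaussian variables bounds that of the second by `exp (-m)`
(`measure_notMem_tamePaths_le`).

If `w` is tame, then `x + B` remains in the strip as soon as, at the mesh times, `B` is close to
`β * w` plus a linear motion leading from the starting point to the middle of the final window, and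
moves little in between. By the Markov property this can be built step by step. A step with
displacement `D` costs a factor `exp (-(D ^ 2 / h + 3))`: this is the Gaussian weight of the
displacement, up to a constant, and the probability of a large excursion within the step is much
smaller (`IsPreBrownianReal.exp_le_measure_mem_and_abs_le`). The sum of `D ^ 2 / h` over the steps
is `O(m)` for a tame path, hence the quenched probability is at least `exp (-K * m)`, uniformly in
the starting point (`exp_le_measure_stripEvent`).

Measurability of the infimum over the uncountably many starting points holds because the strip
event is closed, so that its probability is upper semicontinuous in `w`, a property which passes to
infima.
-/

/-! ### Gaussian estimates and the maximal inequality -/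

section

theorem gaussianReal_real_Ici_le {v : ℝ≥0} (hv : v ≠ 0) {ρ : ℝ} (hρ : 0 ≤ ρ) :
    (gaussianReal 0 v).real (Set.Ici ρ) ≤ Real.exp (-(ρ ^ 2 / (2 * v))) := by
  have hv' : (0 : ℝ) < v := by positivity
  have h := measure_ge_le_exp_mul_mgf (μ := gaussianReal 0 v) (X := id) ρ (t := ρ / v)
    (by positivity) (by simpa using integrable_exp_mul_gaussianReal (μ := 0) (v := v) (ρ / v))
  rw [mgf_id_gaussianReal, ← Real.exp_add] at h
  refine h.trans (le_of_eq ?_)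
  congr 1
  field_simp
  ring

theorem half_le_gaussianReal_Ici (v : ℝ≥0) : 1 / 2 ≤ (gaussianReal 0 v).real (Set.Ici 0) := by
  have h1 : (gaussianReal 0 v).real (Set.Iic 0) = (gaussianReal 0 v).real (Set.Ici 0) := by
    have h := gaussianReal_map_neg (μ := 0) (v := v)
    rw [neg_zero] at h
    rw [← h, map_measureReal_apply (by fun_prop) measurableSet_Iic, h]
    congr 1
    ext x
    simp
  have h2 : (1 : ℝ) ≤ (gaussianReal 0 v).real (Set.Iic 0) + (gaussianReal 0 v).real (Set.Ici 0) := by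
    rw [← probReal_univ (μ := gaussianReal 0 v), ← Set.Iic_union_Ici (a := (0 : ℝ))]
    exact measureReal_union_le _ _
  linarith

/-- An interval of length one standard deviation with an endpoint at `D` has Gaussian mass at least
`exp (-(D ^ 2 / v + 2))`: on it `z ^ 2 ≤ 2 * D ^ 2 + 2 * v`, and the remaining factor
`1 / √(2 * π)` of the density is at least `exp (-1)`. -/
theorem exp_le_gaussianReal_Icc {v : ℝ≥0} (hv : v ≠ 0) {D : ℝ} {I : Set ℝ}
    (hI : I = Set.Icc D (D + √v) ∨ I = Set.Icc (D - √v) D) :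
    Real.exp (-(D ^ 2 / v + 2)) ≤ (gaussianReal 0 v).real I := by
  have hv' : (0 : ℝ) < v := by positivity
  have hs : √(v : ℝ) ^ 2 = v := Real.sq_sqrt hv'.le
  have hs0 : 0 < √(v : ℝ) := Real.sqrt_pos.2 hv'
  have hvol : volume.real I = √v := by
    rcases hI with rfl | rfl <;> simp [Real.volume_real_Icc]
  have hmeas : MeasurableSet I := by
    rcases hI with rfl | rfl <;> exact measurableSet_Icc
  have hfin : volume I ≠ ∞ := by
    rcases hI with rfl | rfl <;> simp
  have hsq : ∀ z ∈ I, z ^ 2 ≤ 2 * D ^ 2 + 2 * v := by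
    rcases hI with rfl | rfl <;> rintro z ⟨h1, h2⟩
    · nlinarith [sq_nonneg (2 * D - z), sq_nonneg (z - D),
        mul_nonneg (sub_nonneg.2 h1) (sub_nonneg.2 h2)]
    · nlinarith [sq_nonneg (2 * D - z), sq_nonneg (z - D),
        mul_nonneg (sub_nonneg.2 h1) (sub_nonneg.2 h2)]
  have hpi : √(2 * Real.pi * v) ≤ Real.exp 1 * √v := by
    rw [Real.sqrt_mul (by positivity)]
    gcongr
    rw [Real.sqrt_le_left (by positivity)]
    nlinarith [Real.pi_lt_d2, Real.exp_one_gt_d9]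
  have hpdf : ∀ z ∈ I, (√(v : ℝ))⁻¹ * Real.exp (-(D ^ 2 / v + 2)) ≤ gaussianPDFReal 0 v z := by
    intro z hz
    have h1 : -(D ^ 2 / v + 1) ≤ -(z - 0) ^ 2 / (2 * v) := by
      rw [neg_div, neg_le_neg_iff, sub_zero, div_le_iff₀ (by positivity)]
      have := hsq z hz
      field_simp
      linarith
    have h2 : (√(v : ℝ))⁻¹ * Real.exp (-1) ≤ (√(2 * Real.pi * v))⁻¹ := by
      rw [Real.exp_neg, ← mul_inv, mul_comm]
      exact inv_anti₀ (by positivity) hpi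
    calc (√(v : ℝ))⁻¹ * Real.exp (-(D ^ 2 / v + 2))
        = ((√(v : ℝ))⁻¹ * Real.exp (-1)) * Real.exp (-(D ^ 2 / v + 1)) := by
          rw [mul_assoc, ← Real.exp_add]; congr 2; ring
      _ ≤ _ := by
          unfold gaussianPDFReal
          gcongr
  rw [measureReal_def, gaussianReal_apply_eq_integral _ hv, ENNReal.toReal_ofReal
    (setIntegral_nonneg hmeas fun z _ => gaussianPDFReal_nonneg _ _ _)]
  calc Real.exp (-(D ^ 2 / v + 2))
      = ∫ z in I, (√(v : ℝ))⁻¹ * Real.exp (-(D ^ 2 / v + 2)) := by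
        rw [setIntegral_const, hvol, smul_eq_mul]; field_simp
    _ ≤ _ := setIntegral_mono_on (integrableOn_const hfin)
        (integrable_gaussianPDFReal _ _).integrableOn hmeas hpdf

/-- Every point of `[0, h]` is a limit of points of the uniform grids of mesh `h / n`. This reduces
events about a continuous path on `[0, h]` to countably many times. -/
theorem exists_tendsto_grid {s h : ℝ≥0} (hs : s ≤ h) :
    ∃ k : ℕ → ℕ, (∀ n, k n ≤ n) ∧ Tendsto (fun n : ℕ => h * (k n / n : ℝ≥0)) atTop (𝓝 s) := by
  rcases eq_or_ne h 0 with rfl | hh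
  · exact ⟨fun _ => 0, by simp, by simp [nonpos_iff_eq_zero.1 hs]⟩
  refine ⟨fun n => ⌊(s / h : ℝ) * n⌋₊, fun n => ?_, ?_⟩
  · have hh' : (0 : ℝ) < h := by positivity
    have : (s / h : ℝ) ≤ 1 := (div_le_one hh').2 (by exact_mod_cast hs)
    refine Nat.floor_le_of_le ?_
    nlinarith [Nat.cast_nonneg (α := ℝ) n]
  · rw [← NNReal.tendsto_coe]
    have h1 := (tendsto_nat_floor_mul_div_atTop (R := ℝ) (a := s / h) (by positivity)).comp
      tendsto_natCast_atTop_atTop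
    have h2 := h1.const_mul (h : ℝ)
    rw [mul_div_cancel₀ _ (by exact_mod_cast hh)] at h2
    simpa [Function.comp_def] using h2

theorem mul_natCast_div_le {h : ℝ≥0} {k n : ℕ} (hk : k ≤ n) : h * (k / n : ℝ≥0) ≤ h := by
  have : (k / n : ℝ≥0) ≤ 1 := div_le_one_of_le₀ (by exact_mod_cast hk) (by positivity)
  simpa using mul_le_mul_right this h

variable {Ω : Type*} [MeasurableSpace Ω] {P : Measure Ω} {X : ℝ≥0 → Ω → ℝ}

theorem measurableSet_forall_abs_increment_le (hc : ∀ ω, Continuous (X · ω)) {u h : ℝ≥0}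
    (hm : ∀ s ≤ u + h, Measurable (X s)) (ρ : ℝ) :
    MeasurableSet {ω | ∀ s ≤ h, |X (u + s) ω - X u ω| ≤ ρ} := by
  have : {ω | ∀ s ≤ h, |X (u + s) ω - X u ω| ≤ ρ} =
      ⋂ (n : ℕ) (k : ℕ) (_ : k ≤ n), {ω | |X (u + h * (k / n : ℝ≥0)) ω - X u ω| ≤ ρ} := by
    ext ω
    simp only [Set.mem_ofPred_eq, Set.mem_iInter]
    refine ⟨fun H n k hk => H _ (mul_natCast_div_le hk), fun H s hs => ?_⟩
    obtain ⟨k, hk, hlim⟩ := exists_tendsto_grid hs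
    have hcont : Continuous fun s => |X (u + s) ω - X u ω| := by
      have := hc ω
      fun_prop
    exact le_of_tendsto ((hcont.tendsto s).comp hlim) (Eventually.of_forall fun n => H n _ (hk n))
  rw [this]
  refine MeasurableSet.iInter fun n => MeasurableSet.iInter fun k =>
    MeasurableSet.iInter fun hk => ?_
  have h1 := hm (u + h * (k / n : ℝ≥0)) (by gcongr; exact mul_natCast_div_le hk)
  have h2 := hm u (by simp)
  exact measurableSet_le (by fun_prop) measurable_const

theorem ProbabilityTheory.IsPreBrownianReal.half_le_measure_increment_nonneg [IsProbabilityMeasure P]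
    (hX : IsPreBrownianReal X P) (s u : ℝ≥0) :
    1 / 2 ≤ P.real {ω | 0 ≤ X s ω - X u ω} := by
  have h := hX.hasLaw_sub s u
  have h1 := half_le_gaussianReal_Ici (nndist s.1 u.1)
  rw [← h.map_eq, map_measureReal_apply_of_aemeasurable h.aemeasurable measurableSet_Ici] at h1
  exact h1

/-- **Lévy's maximal inequality** along a sequence of times: after the first time the process
exceeds `ρ`, the independent and symmetric remaining increment is nonnegative with probability at
least `1 / 2`. -/
theorem ProbabilityTheory.IsPreBrownianReal.measure_exists_lt_le_two_mul [IsProbabilityMeasure P]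
    (hX : IsPreBrownianReal X P) (hm : ∀ s, Measurable (X s)) {t : ℕ → ℝ≥0} (ht : Monotone t)
    (n : ℕ) (ρ : ℝ) :
    P.real {ω | ∃ k ≤ n, ρ < X (t k) ω} ≤ 2 * P.real {ω | ρ < X (t n) ω} := by
  -- `A k`: the level `ρ` is first exceeded at time `t k`
  set A : ℕ → Set Ω := fun k => {ω | ρ < X (t k) ω ∧ ∀ j < k, X (t j) ω ≤ ρ} with hA
  set E : ℕ → Set Ω := fun k => {ω | 0 ≤ X (t n) ω - X (t k) ω} with hE
  -- Stated for every σ-algebra, since `A k` also has to belong to the past of `t k`.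
  have hAm : ∀ {m : MeasurableSpace Ω} (k), (∀ j ≤ k, Measurable[m] (X (t j))) →
      MeasurableSet[m] (A k) := by
    intro m k hk
    have : A k = {ω | ρ < X (t k) ω} ∩ ⋂ (j : ℕ) (_ : j < k), {ω | X (t j) ω ≤ ρ} := by
      ext ω; simp [hA]
    rw [this]
    refine (measurableSet_lt measurable_const (hk k le_rfl)).inter (MeasurableSet.iInter fun j =>
      MeasurableSet.iInter fun hj => measurableSet_le (hk j hj.le) measurable_const)
  have hEm : ∀ k, MeasurableSet (E k) := fun k =>
    measurableSet_le measurable_const ((hm _).sub (hm _))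
  have hdisj : ∀ i j : ℕ, i ≠ j → Disjoint (A i) (A j) := by
    intro i j hij
    rw [Set.disjoint_left]
    rintro ω ⟨h1, h2⟩ ⟨h3, h4⟩
    rcases lt_or_gt_of_ne hij with h | h
    · exact absurd h1 (not_lt.2 (h4 i h))
    · exact absurd h3 (not_lt.2 (h2 j h))
  have hunion : {ω | ∃ k ≤ n, ρ < X (t k) ω} = ⋃ k ∈ Finset.range (n + 1), A k := by
    ext ω
    simp only [Set.mem_ofPred_eq, Set.mem_iUnion, Finset.mem_range, Order.lt_add_one_iff, exists_prop]
    constructor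
    · rintro ⟨k, hk, h⟩
      have hex : ∃ k, ρ < X (t k) ω := ⟨k, h⟩
      classical
      exact ⟨Nat.find hex, (Nat.find_min' hex h).trans hk, Nat.find_spec hex,
        fun j hj => not_lt.1 (Nat.find_min hex hj)⟩
    · rintro ⟨k, hk, h⟩
      exact ⟨k, hk, h.1⟩
  have hind : ∀ k ≤ n, P.real (A k ∩ E k) = P.real (A k) * P.real (E k) := by
    intro k hk
    have hI := hX.indepFun_shift (t k)
    rw [IndepFun_iff] at hI
    have := hI (E k) (A k) ?_ ?_
    · rw [measureReal_def, Set.inter_comm, this, ENNReal.toReal_mul, mul_comm]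
      rfl
    · have hmeas : Measurable fun f : ℝ≥0 → ℝ => f (t n - t k) := by fun_prop
      refine ⟨{f | 0 ≤ f (t n - t k)}, measurableSet_le measurable_const hmeas, ?_⟩
      ext ω
      simp [hE, add_tsub_cancel_of_le (ht hk)]
    · refine hAm k fun j hj => ?_
      exact (measurable_pi_apply (X := fun _ : Set.Iic (t k) => ℝ) ⟨t j, ht hj⟩).comp
        (comap_measurable _)
  calc P.real {ω | ∃ k ≤ n, ρ < X (t k) ω}
      = ∑ k ∈ Finset.range (n + 1), P.real (A k) := by
        rw [hunion, measureReal_biUnion_finset (fun i _ j _ hij => hdisj i j hij)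
          (fun k _ => hAm k fun j _ => hm _)]
    _ ≤ ∑ k ∈ Finset.range (n + 1), 2 * P.real (A k ∩ E k) := by
        refine Finset.sum_le_sum fun k hk => ?_
        rw [hind k (by simpa [Nat.lt_succ_iff] using hk)]
        nlinarith [hX.half_le_measure_increment_nonneg (t n) (t k),
          measureReal_nonneg (μ := P) (s := A k)]
    _ = 2 * P.real (⋃ k ∈ Finset.range (n + 1), A k ∩ E k) := by
        rw [← Finset.mul_sum, measureReal_biUnion_finset
          (fun i _ j _ hij => (hdisj i j hij).mono Set.inter_subset_left Set.inter_subset_left)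
          (fun k _ => (hAm k fun j _ => hm _).inter (hEm k))]
    _ ≤ _ := by
        refine mul_le_mul_of_nonneg_left (measureReal_mono ?_) zero_le_two
        refine Set.iUnion₂_subset fun k _ ω hω => ?_
        have h1 : ρ < X (t k) ω := hω.1.1
        have h2 : 0 ≤ X (t n) ω - X (t k) ω := hω.2
        show ρ < X (t n) ω
        linarith

theorem ProbabilityTheory.IsPreBrownianReal.measure_exists_le_lt_le [IsProbabilityMeasure P]
    (hX : IsPreBrownianReal X P) (hm : ∀ s, Measurable (X s)) (hc : ∀ ω, Continuous (X · ω))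
    (h : ℝ≥0) (ρ : ℝ) :
    P.real {ω | ∃ s ≤ h, ρ < X s ω} ≤ 2 * P.real {ω | ρ < X h ω} := by
  set E : ℕ → Set Ω := fun n => {ω | ∃ k ≤ n, ρ < X (h * (k / n : ℝ≥0)) ω} with hE
  have hEP : ∀ n, n ≠ 0 → P.real (E n) ≤ 2 * P.real {ω | ρ < X h ω} := by
    intro n hn
    have := hX.measure_exists_lt_le_two_mul hm (t := fun k => h * (k / n : ℝ≥0))
      (fun i j hij => by dsimp only; gcongr) n ρ
    simpa [hn] using this
  -- By continuity, an exceedance on `[0, h]` is seen on all sufficiently fine grids. The index is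
  -- shifted because the grid with `n = 0` is the single point `0`.
  have hsub : {ω | ∃ s ≤ h, ρ < X s ω} ⊆ ⋃ N, ⋂ n ≥ N, E (n + 1) := by
    rintro ω ⟨s, hs, hω⟩
    obtain ⟨k, hk, hlim⟩ := exists_tendsto_grid hs
    have hev := (((hc ω).tendsto s).comp hlim).eventually (lt_mem_nhds hω)
    obtain ⟨N, hN⟩ := eventually_atTop.1 hev
    simp only [Set.mem_iUnion, Set.mem_iInter]
    exact ⟨N, fun n hn => ⟨k (n + 1), hk _, hN (n + 1) (by omega)⟩⟩
  have hmono : Monotone fun N => ⋂ n ≥ N, E (n + 1) := fun N M hNM =>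
    Set.biInter_mono (fun n hn => le_trans hNM hn) fun _ _ => le_rfl
  refine (measureReal_mono hsub).trans ?_
  rw [measureReal_def, hmono.measure_iUnion]
  refine ENNReal.toReal_le_of_le_ofReal (by positivity) (iSup_le fun N => ?_)
  refine (measure_mono (Set.iInter₂_subset N le_rfl)).trans ?_
  rw [← ofReal_measureReal]
  exact ENNReal.ofReal_le_ofReal (hEP (N + 1) (by omega))

theorem ProbabilityTheory.IsPreBrownianReal.measure_exists_le_lt_abs_le [IsProbabilityMeasure P]
    (hX : IsPreBrownianReal X P) (hm : ∀ s, Measurable (X s)) (hc : ∀ ω, Continuous (X · ω))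
    {h : ℝ≥0} (hh : h ≠ 0) {ρ : ℝ} (hρ : 0 ≤ ρ) :
    P.real {ω | ∃ s ≤ h, ρ < |X s ω|} ≤ 4 * Real.exp (-(ρ ^ 2 / (2 * h))) := by
  have key : ∀ Y : ℝ≥0 → Ω → ℝ, IsPreBrownianReal Y P → (∀ s, Measurable (Y s)) →
      (∀ ω, Continuous (Y · ω)) →
      P.real {ω | ∃ s ≤ h, ρ < Y s ω} ≤ 2 * Real.exp (-(ρ ^ 2 / (2 * h))) := by
    intro Y hY hYm hYc
    refine (hY.measure_exists_le_lt_le hYm hYc h ρ).trans ?_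
    gcongr
    refine le_trans ?_ (gaussianReal_real_Ici_le hh hρ)
    rw [← (hY.hasLaw_eval h).map_eq, map_measureReal_apply (hYm h) measurableSet_Ici]
    exact measureReal_mono fun ω hω => (show ρ < Y h ω from hω).le
  have h1 := key X hX hm hc
  have h2 := key (-X) hX.neg (fun s => (hm s).neg) (fun ω => (hc ω).neg)
  have h3 : {ω | ∃ s ≤ h, ρ < |X s ω|} ⊆
      {ω | ∃ s ≤ h, ρ < X s ω} ∪ {ω | ∃ s ≤ h, ρ < (-X) s ω} := by
    rintro ω ⟨s, hs, hω⟩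
    rcases lt_abs.1 hω with h | h
    · exact Or.inl ⟨s, hs, h⟩
    · exact Or.inr ⟨s, hs, h⟩
  have := (measureReal_mono (μ := P) h3).trans (measureReal_union_le _ _)
  linarith

end

/-! ### Following a moving centre -/

section

variable {Ω : Type*} [MeasurableSpace Ω] {P : Measure Ω} {X : ℝ≥0 → Ω → ℝ}

/-- The cost of one step: within time `h`, the process reaches an interval of length `√h` with an
endpoint at `D` without leaving `[-ρ, ρ]`, with probability at least `exp (-(D ^ 2 / h + 3))`,
provided `|D|` and `√h` are small compared with `ρ`. -/
theorem ProbabilityTheory.IsPreBrownianReal.exp_le_measure_mem_and_abs_le [IsProbabilityMeasure P]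
    (hX : IsPreBrownianReal X P) (hm : ∀ s, Measurable (X s)) (hc : ∀ ω, Continuous (X · ω))
    {h : ℝ≥0} (hh : h ≠ 0) {ρ D : ℝ} (hρ : 0 ≤ ρ) (hD : |D| ≤ ρ / 2) (hhρ : 16 * (h : ℝ) ≤ ρ ^ 2)
    {I : Set ℝ} (hI : I = Set.Icc D (D + √h) ∨ I = Set.Icc (D - √h) D) :
    Real.exp (-(D ^ 2 / h + 3)) ≤ P.real {ω | X h ω ∈ I ∧ ∀ s ≤ h, |X s ω| ≤ ρ} := by
  have hh' : (0 : ℝ) < h := by positivity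
  have hmeas : MeasurableSet I := by
    rcases hI with rfl | rfl <;> exact measurableSet_Icc
  have h1 := exp_le_gaussianReal_Icc hh hI
  rw [← (hX.hasLaw_eval h).map_eq, map_measureReal_apply (hm h) hmeas] at h1
  have h2 := hX.measure_exists_le_lt_abs_le hm hc hh hρ
  have h3 : X h ⁻¹' I ⊆
      {ω | X h ω ∈ I ∧ ∀ s ≤ h, |X s ω| ≤ ρ} ∪ {ω | ∃ s ≤ h, ρ < |X s ω|} := by
    intro ω hω
    by_cases H : ∃ s ≤ h, ρ < |X s ω|
    · exact Or.inr H
    · push Not at H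
      exact Or.inl ⟨hω, H⟩
  have h4 := (measureReal_mono (μ := P) h3).trans (measureReal_union_le _ _)
  have hD2 : D ^ 2 ≤ ρ ^ 2 / 4 := by
    rw [← sq_abs D]
    nlinarith [abs_nonneg D]
  -- The probability of leaving `[-ρ, ρ]` is negligible: its exponent `ρ ^ 2 / (2 * h)` exceeds
  -- `D ^ 2 / h` by at least `ρ ^ 2 / (4 * h) ≥ 4`.
  have h5 : Real.exp (-(ρ ^ 2 / (2 * h))) ≤ Real.exp (-(D ^ 2 / h + 3)) * Real.exp (-1) := by
    rw [← Real.exp_add]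
    refine Real.exp_le_exp.2 ?_
    have e1 : D ^ 2 / h ≤ ρ ^ 2 / (4 * h) := by
      rw [div_le_div_iff₀ hh' (by positivity)]
      nlinarith
    have e2 : 4 ≤ ρ ^ 2 / (4 * h) := by
      rw [le_div_iff₀ (by positivity)]
      linarith
    have e3 : ρ ^ 2 / (2 * h) = ρ ^ 2 / (4 * h) + ρ ^ 2 / (4 * h) := by field_simp; ring
    linarith
  have h6 : Real.exp (-(D ^ 2 / h + 2)) = Real.exp (-(D ^ 2 / h + 3)) * Real.exp 1 := by
    rw [← Real.exp_add]
    congr 1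
    ring
  have h7 := Real.exp_pos (-(D ^ 2 / h + 3))
  nlinarith [Real.exp_one_gt_d9, Real.exp_neg_one_lt_d9]

/-- The event that on each of the first `m` mesh intervals of length `h` the process stays within
`ρ` of its value at the left endpoint, and that it is within `r` of `z k` at each time `k * h`,
`k ≤ m`. -/
def tubeEvent {Ω : Type*} (X : ℝ≥0 → Ω → ℝ) (h : ℝ≥0) (ρ r : ℝ) (z : ℕ → ℝ) (m : ℕ) : Set Ω :=
  {ω | (∀ k < m, ∀ s ≤ h, |X (k * h + s) ω - X (k * h) ω| ≤ ρ) ∧ ∀ k ≤ m, |X (k * h) ω - z k| ≤ r}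

theorem measurableSet_tubeEvent (hc : ∀ ω, Continuous (X · ω)) {h : ℝ≥0} {m : ℕ}
    (hm : ∀ s ≤ m * h, Measurable (X s)) (ρ r : ℝ) (z : ℕ → ℝ) :
    MeasurableSet (tubeEvent X h ρ r z m) := by
  have : tubeEvent X h ρ r z m =
      (⋂ (k : ℕ) (_ : k < m), {ω | ∀ s ≤ h, |X (k * h + s) ω - X (k * h) ω| ≤ ρ}) ∩
        ⋂ (k : ℕ) (_ : k ≤ m), {ω | |X (k * h) ω - z k| ≤ r} := by
    ext ω
    simp [tubeEvent]
  rw [this]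
  refine (MeasurableSet.iInter fun k => MeasurableSet.iInter fun hk => ?_).inter
    (MeasurableSet.iInter fun k => MeasurableSet.iInter fun hk => ?_)
  · refine measurableSet_forall_abs_increment_le hc (fun s hs => hm s (hs.trans ?_)) ρ
    have : ((k + 1 : ℕ) : ℝ≥0) ≤ m := by exact_mod_cast hk
    calc (k : ℝ≥0) * h + h = ((k + 1 : ℕ) : ℝ≥0) * h := by push_cast; ring
      _ ≤ m * h := by gcongr
  · have h2 := hm (k * h) (by gcongr)
    exact measurableSet_le (by fun_prop) measurable_const

/-- The Markov property at time `u`: a past event is independent of the event that the increments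
after `u` stay within `ρ` up to time `u + h` and have terminal value in `I`. -/
theorem ProbabilityTheory.IsPreBrownianReal.measure_inter_increment [IsProbabilityMeasure P]
    (hX : IsPreBrownianReal X P) (hc : ∀ ω, Continuous (X · ω)) (u h : ℝ≥0) (ρ : ℝ)
    {I : Set ℝ} (hI : MeasurableSet I) {A : Set Ω}
    (hA : MeasurableSet[MeasurableSpace.comap (fun ω (s : Set.Iic u) => X s ω) inferInstance] A) :
    P.real (A ∩ {ω | X (u + h) ω - X u ω ∈ I ∧ ∀ s ≤ h, |X (u + s) ω - X u ω| ≤ ρ}) =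
      P.real A *
        P.real {ω | X (u + h) ω - X u ω ∈ I ∧ ∀ s ≤ h, |X (u + s) ω - X u ω| ≤ ρ} := by
  have hind := hX.indepFun_shift u
  rw [IndepFun_iff] at hind
  rw [measureReal_def, Set.inter_comm, hind _ _ ?_ hA, ENNReal.toReal_mul, mul_comm]
  · rfl
  have hY : ∀ s, Measurable[MeasurableSpace.comap (fun ω t => X (u + t) ω - X u ω) inferInstance]
      fun ω => X (u + s) ω - X u ω := fun s =>
    (measurable_pi_apply (X := fun _ : ℝ≥0 => ℝ) s).comp (comap_measurable _)
  refine MeasurableSet.inter (hY h hI) ?_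
  have := @measurableSet_forall_abs_increment_le Ω
    (MeasurableSpace.comap (fun ω t => X (u + t) ω - X u ω) inferInstance)
    (fun s ω => X (u + s) ω - X u ω) (fun ω => by have := hc ω; fun_prop) 0 h (fun s _ => hY s) ρ
  simp only [zero_add, add_zero, sub_self, sub_zero] at this
  exact this

/-- Prolonging the tube by one step costs a factor `exp (-(D ^ 2 / h + 3))`, where `D` is the
displacement of its centre. The increment is asked to fall into `[D, D + √h]` when the process is
below the centre `z m` and into `[D - √h, D]` when it is above, which keeps it within `r ≥ √h` of
the next centre. As the target depends on the past only through this dichotomy, independence of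
two events suffices and no integration over the current position is needed. -/
theorem ProbabilityTheory.IsPreBrownianReal.exp_mul_le_measure_tubeEvent_succ
    [IsProbabilityMeasure P]
    (hX : IsPreBrownianReal X P) (hm : ∀ s, Measurable (X s)) (hc : ∀ ω, Continuous (X · ω))
    {h : ℝ≥0} (hh : h ≠ 0) {ρ r : ℝ} (hρ : 0 ≤ ρ) (hhρ : 16 * (h : ℝ) ≤ ρ ^ 2) (hr : √h ≤ r)
    (z : ℕ → ℝ) (m : ℕ) (hz : |z (m + 1) - z m| ≤ ρ / 2) :
    Real.exp (-((z (m + 1) - z m) ^ 2 / h + 3)) * P.real (tubeEvent X h ρ r z m) ≤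
      P.real (tubeEvent X h ρ r z (m + 1)) := by
  set D := z (m + 1) - z m with hD
  set u : ℝ≥0 := m * h with hu
  set F : Set ℝ → Set Ω := fun I =>
    {ω | X (u + h) ω - X u ω ∈ I ∧ ∀ s ≤ h, |X (u + s) ω - X u ω| ≤ ρ} with hF
  set A := tubeEvent X h ρ r z m with hA
  have hXu : ∀ s ≤ u,
      Measurable[MeasurableSpace.comap (fun ω (s : Set.Iic u) => X s ω) inferInstance] (X s) :=
    fun s hs => (measurable_pi_apply (X := fun _ : Set.Iic u => ℝ) ⟨s, hs⟩).comp (comap_measurable _)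
  have hAm := @measurableSet_tubeEvent Ω
    (MeasurableSpace.comap (fun ω (s : Set.Iic u) => X s ω) inferInstance) X hc h m hXu ρ r z
  have hle : ∀ I, (I = Set.Icc D (D + √h) ∨ I = Set.Icc (D - √h) D) →
      Real.exp (-(D ^ 2 / h + 3)) ≤ P.real (F I) := fun I hI =>
    (hX.shift u).exp_le_measure_mem_and_abs_le (fun s => (hm _).sub (hm _))
      (fun ω => by have := hc ω; fun_prop) hh hρ hz hhρ hI
  have hmeasI : ∀ {a b : ℝ}, MeasurableSet (Set.Icc a b) := measurableSet_Icc
  set A₁ := A ∩ {ω | X u ω ≤ z m} with hA₁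
  set A₂ := A \ {ω | X u ω ≤ z m} with hA₂
  have hSm := hXu u le_rfl (measurableSet_Iic (a := z m))
  have i1 := hX.measure_inter_increment hc u h ρ (hmeasI (a := D) (b := D + √h)) (hAm.inter hSm)
  have i2 := hX.measure_inter_increment hc u h ρ (hmeasI (a := D - √h) (b := D)) (hAm.diff hSm)
  have hS : MeasurableSet {ω | X u ω ≤ z m} := measurableSet_le (hm u) measurable_const
  have hsplit : P.real A₁ + P.real A₂ = P.real A := measureReal_inter_add_sdiff hS
  have hmem : ∀ ω ∈ A, |X (u + h) ω - X u ω + (X u ω - z m) - D| ≤ r →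
      (∀ s ≤ h, |X (u + s) ω - X u ω| ≤ ρ) → ω ∈ tubeEvent X h ρ r z (m + 1) := by
    intro ω hω h1 h2
    refine ⟨fun k hk => ?_, fun k hk => ?_⟩
    · rcases Nat.lt_succ_iff_lt_or_eq.1 hk with hk | rfl
      · exact hω.1 k hk
      · exact h2
    · rcases Nat.le_succ_iff.1 hk with hk | rfl
      · exact hω.2 k hk
      · have e : ((m + 1 : ℕ) : ℝ≥0) * h = u + h := by rw [hu]; push_cast; ring
        rw [Nat.succ_eq_add_one, e]
        convert h1 using 2
        rw [hD]; ring
  have hs0 : 0 ≤ √(h : ℝ) := Real.sqrt_nonneg _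
  have hsub : (A₁ ∩ F (Set.Icc D (D + √h))) ∪ (A₂ ∩ F (Set.Icc (D - √h) D)) ⊆
      tubeEvent X h ρ r z (m + 1) := by
    rintro ω (⟨⟨h1, h2⟩, ⟨h3, h4⟩, h5⟩ | ⟨⟨h1, h2⟩, ⟨h3, h4⟩, h5⟩)
    · have h6 := abs_le.1 (h1.2 m le_rfl)
      have h2 : X u ω ≤ z m := h2
      exact hmem ω h1 (abs_le.2 ⟨by linarith, by linarith⟩) h5
    · have h6 := abs_le.1 (h1.2 m le_rfl)
      have h2 : z m < X u ω := not_le.1 h2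
      exact hmem ω h1 (abs_le.2 ⟨by linarith, by linarith⟩) h5
  have hdisj : Disjoint (A₁ ∩ F (Set.Icc D (D + √h))) (A₂ ∩ F (Set.Icc (D - √h) D)) :=
    Set.disjoint_left.2 fun ω h1 h2 => h2.1.2 h1.1.2
  have hFm : MeasurableSet (F (Set.Icc (D - √h) D)) :=
    (((hm _).sub (hm _)) hmeasI).inter (measurableSet_forall_abs_increment_le hc (fun s _ => hm s) ρ)
  have hA₂m : MeasurableSet A₂ := (measurableSet_tubeEvent hc (fun s _ => hm s) ρ r z).diff hS
  calc Real.exp (-(D ^ 2 / h + 3)) * P.real A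
      = P.real A₁ * Real.exp (-(D ^ 2 / h + 3)) + P.real A₂ * Real.exp (-(D ^ 2 / h + 3)) := by
        rw [← hsplit]; ring
    _ ≤ P.real A₁ * P.real (F (Set.Icc D (D + √h))) +
          P.real A₂ * P.real (F (Set.Icc (D - √h) D)) := by
        gcongr
        · exact hle _ (Or.inl rfl)
        · exact hle _ (Or.inr rfl)
    _ = P.real ((A₁ ∩ F (Set.Icc D (D + √h))) ∪ (A₂ ∩ F (Set.Icc (D - √h) D))) := by
        rw [measureReal_union hdisj (hA₂m.inter hFm)]
        exact congrArg₂ _ i1.symm i2.symm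
    _ ≤ _ := measureReal_mono hsub

theorem ProbabilityTheory.IsPreBrownianReal.exp_le_measure_tubeEvent [IsProbabilityMeasure P]
    (hX : IsPreBrownianReal X P) (hm : ∀ s, Measurable (X s)) (hc : ∀ ω, Continuous (X · ω))
    {h : ℝ≥0} (hh : h ≠ 0) {ρ r : ℝ} (hρ : 0 ≤ ρ) (hhρ : 16 * (h : ℝ) ≤ ρ ^ 2) (hr : √h ≤ r)
    {z : ℕ → ℝ} (hz₀ : z 0 = 0) {m : ℕ} (hz : ∀ k < m, |z (k + 1) - z k| ≤ ρ / 2) :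
    Real.exp (-∑ k ∈ Finset.range m, ((z (k + 1) - z k) ^ 2 / h + 3)) ≤
      P.real (tubeEvent X h ρ r z m) := by
  induction m with
  | zero =>
    have h1 : ∀ᵐ ω ∂P, ω ∈ tubeEvent X h ρ r z 0 := by
      filter_upwards [hX.eval_zero_ae_eq_zero] with ω hω
      have : 0 ≤ r := (Real.sqrt_nonneg _).trans hr
      simpa [tubeEvent, hω, hz₀] using this
    have h2 : P (tubeEvent X h ρ r z 0) = 1 := (prob_compl_eq_zero_iff
      (measurableSet_tubeEvent hc (fun s _ => hm s) ρ r z)).1 h1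
    simp [measureReal_def, h2]
  | succ m ih =>
    have h1 := ih fun k hk => hz k (by omega)
    refine le_trans ?_
      (hX.exp_mul_le_measure_tubeEvent_succ hm hc hh hρ hhρ hr z m (hz m (by omega)))
    rw [Finset.sum_range_succ, neg_add, Real.exp_add, mul_comm]
    gcongr

end

/-! ### The strip around a tame path -/

/-- The paths that oscillate by at most `δ` on each of the first `m` mesh intervals of length `h`,
and whose quadratic variation along that mesh is at most `8 * m * h`, eight times its mean for
Brownian motion. -/
def tamePaths (h : ℝ≥0) (δ : ℝ) (m : ℕ) : Set C(ℝ≥0, ℝ) :=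
  {w | (∀ k < m, ∀ s ≤ h, |w (k * h + s) - w (k * h)| ≤ δ) ∧
    ∑ k ∈ Finset.range m, (w ((k + 1 : ℕ) * h) - w (k * h)) ^ 2 ≤ 8 * m * h}

theorem exists_mesh_interval {h s : ℝ≥0} {m : ℕ} (hh : h ≠ 0) (hm : m ≠ 0) (hs : s ≤ m * h) :
    ∃ k < m, ∃ u ≤ h, s = k * h + u := by
  have hh' : 0 < h := by positivity
  obtain ⟨n, rfl⟩ := Nat.exists_eq_succ_of_ne_zero hm
  rcases le_total (n * h) s with H | H
  · refine ⟨n, by omega, s - n * h, ?_, (add_tsub_cancel_of_le H).symm⟩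
    rw [tsub_le_iff_left]
    refine hs.trans (le_of_eq ?_)
    push_cast
    ring
  · have h1 : (⌊s / h⌋₊ : ℝ≥0) * h ≤ s := by
      rw [← le_div_iff₀ hh']
      exact Nat.floor_le (by positivity)
    rcases H.eq_or_lt with rfl | H
    · exact ⟨n, by omega, 0, by simp, by simp⟩
    refine ⟨⌊s / h⌋₊, ?_, s - ⌊s / h⌋₊ * h, ?_, (add_tsub_cancel_of_le h1).symm⟩
    · rw [Nat.floor_lt (by positivity), div_lt_iff₀ hh']
      exact H.trans_le (by push_cast; gcongr; simp)
    · rw [tsub_le_iff_left]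
      have := (Nat.lt_floor_add_one (s / h)).le
      rw [div_le_iff₀ hh'] at this
      linarith

/-- If `β * w` oscillates by at most `η / 8` on the mesh intervals, the strip event contains the tube
event whose centre follows `β * w` plus a linear motion from `0` to `(a' + b') / 2 - x`. Both `x`
and `(a' + b') / 2` are at distance at least `η` from the ends of `[a, b]`, and the deviations
`η / 2`, `η / 4` and `η / 8` add up to less than `η`. -/
theorem tubeEvent_subset_stripEvent {Ω : Type*} {B : Ω → C(ℝ≥0, ℝ)} {β a b a' b' η x : ℝ}
    {w : C(ℝ≥0, ℝ)} {h : ℝ≥0} {m : ℕ} (hh : h ≠ 0) (hm : m ≠ 0) (hβ : 0 < β)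
    (hxa : a + η ≤ x) (hxb : x + η ≤ b) (ha' : a + η ≤ (a' + b') / 2) (hb' : (a' + b') / 2 + η ≤ b)
    (hη : η ≤ (b' - a') / 2) (hη₀ : 0 < η)
    (hw : ∀ k < m, ∀ s ≤ h, |w (k * h + s) - w (k * h)| ≤ η / (8 * β)) :
    tubeEvent (fun s ω => B ω s) h (η / 2) (η / 4)
        (fun k => β * w (k * h) + k / m * ((a' + b') / 2 - x)) m ⊆
      {ω | (B ω, w) ∈ stripEvent β a b a' b' (m * h) x} := by
  rintro ω ⟨h1, h2⟩
  refine ⟨fun s hs => ?_, ?_⟩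
  · obtain ⟨k, hk, u, hu, rfl⟩ := exists_mesh_interval hh hm hs
    have i1 := abs_le.1 (h1 k hk u hu)
    have i2 := abs_le.1 (h2 k hk.le)
    have i3 : |β * (w (k * h + u) - w (k * h))| ≤ η / 8 := by
      rw [abs_mul, abs_of_pos hβ]
      calc β * |w (k * h + u) - w (k * h)| ≤ β * (η / (8 * β)) := by gcongr; exact hw k hk u hu
        _ = η / 8 := by field_simp
    have i3 := abs_le.1 i3
    have hkm0 : (0 : ℝ) ≤ k / m := by positivity
    have hkm1 : (k / m : ℝ) ≤ 1 := div_le_one_of_le₀ (by exact_mod_cast hk.le) (by positivity)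
    dsimp only at i1 i2 ⊢
    constructor <;> nlinarith
  · have i2 := abs_le.1 (h2 m le_rfl)
    dsimp only at i2 ⊢
    rw [div_self (by exact_mod_cast hm)] at i2
    constructor <;> linarith

/-- For a tame path `w`, the probability of the strip event is at least `exp (-K * m)` with `K`
independent of `w`, of the starting point and of `m`: the squared displacements of the tube
sum to at most a constant, and division by `h = t / m` makes the cost of the `m` steps `O(m)`. -/
theorem exp_le_measure_stripEvent {Ω : Type*} [MeasurableSpace Ω] {P : Measure Ω}
    [IsProbabilityMeasure P] {B : Ω → C(ℝ≥0, ℝ)} (hBm : Measurable B)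
    (hB : IsPreBrownianReal (fun (s : ℝ≥0) (ω : Ω) => B ω s) P) {β a b a' b' η x : ℝ}
    {w : C(ℝ≥0, ℝ)} {t : ℝ≥0} {m : ℕ} (ht : t ≠ 0) (hm : m ≠ 0) (hβ : 0 < β)
    (hxa : a + η ≤ x) (hxb : x + η ≤ b) (ha' : a + η ≤ (a' + b') / 2) (hb' : (a' + b') / 2 + η ≤ b)
    (hη : η ≤ (b' - a') / 2) (hη₀ : 0 < η) (hmt : 64 * t ≤ η ^ 2 * m) (hmb : 8 * (b - a) ≤ η * m)
    (hw₀ : w 0 = 0) (hw : w ∈ tamePaths (t / m) (η / (8 * β)) m) :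
    Real.exp (-((16 * β ^ 2 + 2 * (b - a) ^ 2 / t + 3) * m)) ≤
      P.real {ω | (B ω, w) ∈ stripEvent β a b a' b' t x} := by
  have hm' : (0 : ℝ) < m := by positivity
  have ht' : (0 : ℝ) < t := by positivity
  have hm1 : (1 : ℝ) ≤ m := by exact_mod_cast Nat.one_le_iff_ne_zero.2 hm
  set h : ℝ≥0 := t / m with hh
  have hh0 : h ≠ 0 := by positivity
  have hh' : (0 : ℝ) < h := by positivity
  have hmh : (m : ℝ≥0) * h = t := by rw [hh]; field_simp
  have hmh' : (m : ℝ) * h = t := by exact_mod_cast congrArg NNReal.toReal hmh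
  have hhη : 64 * (h : ℝ) ≤ η ^ 2 := by
    rw [← hmh'] at hmt
    nlinarith
  have hsqrt : √(h : ℝ) ≤ η / 4 := by
    rw [Real.sqrt_le_left (by positivity)]
    nlinarith
  set y := (a' + b') / 2 - x with hy
  set z : ℕ → ℝ := fun k => β * w (k * h) + k / m * y with hz
  have hyab : |y| ≤ b - a := abs_le.2 ⟨by linarith, by linarith⟩
  have hdz : ∀ k, z (k + 1) - z k = β * (w ((k + 1 : ℕ) * h) - w (k * h)) + y / m := by
    intro k
    simp only [hz]
    push_cast
    field_simp
    ring
  have hdz1 : ∀ k < m, |z (k + 1) - z k| ≤ η / 2 / 2 := by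
    intro k hk
    rw [hdz]
    have i1 : |w ((k + 1 : ℕ) * h) - w (k * h)| ≤ η / (8 * β) := by
      have := hw.1 k hk h le_rfl
      rwa [show (k : ℝ≥0) * h + h = ((k + 1 : ℕ) : ℝ≥0) * h by push_cast; ring] at this
    have i2 : |y / m| ≤ η / 8 := by
      rw [abs_div, abs_of_pos hm', div_le_iff₀ hm']
      linarith
    calc _ ≤ |β * (w ((k + 1 : ℕ) * h) - w (k * h))| + |y / m| := abs_add_le _ _
      _ ≤ β * (η / (8 * β)) + η / 8 := by
        rw [abs_mul, abs_of_pos hβ]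
        gcongr
      _ = η / 2 / 2 := by field_simp; ring
  have hz₀ : z 0 = 0 := by simp [hz, hw₀]
  have key := hB.exp_le_measure_tubeEvent (fun s => (continuous_eval_const s).measurable.comp hBm)
    (fun ω => (B ω).continuous) hh0 (ρ := η / 2) (r := η / 4) (by positivity) (by nlinarith) hsqrt
    hz₀ hdz1
  have hsum : ∑ k ∈ Finset.range m, ((z (k + 1) - z k) ^ 2 / h + 3) ≤
      (16 * β ^ 2 + 2 * (b - a) ^ 2 / t + 3) * m := by
    have i1 : ∀ k, (z (k + 1) - z k) ^ 2 / h + 3 ≤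
        2 * β ^ 2 / h * (w ((k + 1 : ℕ) * h) - w (k * h)) ^ 2 +
          (2 * (b - a) ^ 2 / (m * t) + 3) := by
      intro k
      have e : (m : ℝ) * t = m ^ 2 * h := by rw [← hmh']; ring
      rw [hdz, e]
      have i2 : y ^ 2 ≤ (b - a) ^ 2 := sq_le_sq' (by linarith [abs_le.1 hyab])
        (by linarith [abs_le.1 hyab])
      set d := w ((k + 1 : ℕ) * h) - w (k * h)
      have i3 : (β * d + y / m) ^ 2 ≤ 2 * β ^ 2 * d ^ 2 + 2 * (b - a) ^ 2 / m ^ 2 := by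
        calc (β * d + y / m) ^ 2 ≤ 2 * β ^ 2 * d ^ 2 + 2 * y ^ 2 / m ^ 2 := by
              have := sq_nonneg (β * d - y / m)
              have e2 : 2 * y ^ 2 / m ^ 2 = 2 * (y / m) ^ 2 := by rw [div_pow]; ring
              rw [e2]
              nlinarith
          _ ≤ _ := by gcongr
      calc (β * d + y / m) ^ 2 / h + 3
          ≤ (2 * β ^ 2 * d ^ 2 + 2 * (b - a) ^ 2 / m ^ 2) / h + 3 := by gcongr
        _ = _ := by field_simp; ring
    calc _ ≤ ∑ k ∈ Finset.range m, (2 * β ^ 2 / h * (w ((k + 1 : ℕ) * h) - w (k * h)) ^ 2 +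
          (2 * (b - a) ^ 2 / (m * t) + 3)) := Finset.sum_le_sum fun k _ => i1 k
      _ = 2 * β ^ 2 / h * ∑ k ∈ Finset.range m, (w ((k + 1 : ℕ) * h) - w (k * h)) ^ 2 +
          m * (2 * (b - a) ^ 2 / (m * t) + 3) := by
        rw [Finset.sum_add_distrib, ← Finset.mul_sum]
        simp only [Finset.sum_const, Finset.card_range, nsmul_eq_mul]
      _ ≤ 2 * β ^ 2 / h * (8 * m * h) + m * (2 * (b - a) ^ 2 / (m * t) + 3) := by
        gcongr
        exact hw.2
      _ = 16 * β ^ 2 * m + 2 * (b - a) ^ 2 / t + 3 * m := by field_simp; ring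
      _ ≤ _ := by
        have : 0 ≤ 2 * (b - a) ^ 2 / t := by positivity
        nlinarith
  refine (Real.exp_le_exp.2 (neg_le_neg hsum)).trans (key.trans (measureReal_mono ?_))
  have := tubeEvent_subset_stripEvent (B := B) (w := w) hh0 hm hβ hxa hxb ha' hb' hη hη₀ hw.1
  rwa [hmh] at this

/-! ### Most paths are tame -/

theorem gaussianPDFReal_mul_exp_sq {v : ℝ≥0} (hv : v ≠ 0) (x : ℝ) :
    gaussianPDFReal 0 v x * Real.exp (1 / (4 * v) * x ^ 2) =
      (√(2 * Real.pi * v))⁻¹ * Real.exp (-(1 / (4 * v)) * x ^ 2) := by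
  have hv' : (0 : ℝ) < v := by positivity
  rw [gaussianPDFReal, mul_assoc, ← Real.exp_add]
  congr 2
  field_simp
  ring

theorem integrable_exp_sq_gaussianReal {v : ℝ≥0} (hv : v ≠ 0) :
    Integrable (fun x : ℝ => Real.exp (1 / (4 * v) * x ^ 2)) (gaussianReal 0 v) := by
  have hv' : (0 : ℝ) < v := by positivity
  rw [gaussianReal_of_var_ne_zero _ hv, integrable_withDensity_iff_integrable_smul'
    (measurable_gaussianPDF _ _) (ae_of_all _ fun _ => gaussianPDF_lt_top)]
  simp only [toReal_gaussianPDF, smul_eq_mul, gaussianPDFReal_mul_exp_sq hv]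
  exact (integrable_exp_neg_mul_sq (by positivity)).const_mul _

theorem integral_exp_sq_gaussianReal {v : ℝ≥0} (hv : v ≠ 0) :
    ∫ x, Real.exp (1 / (4 * v) * x ^ 2) ∂(gaussianReal 0 v) = √2 := by
  have hv' : (0 : ℝ) < v := by positivity
  rw [integral_gaussianReal_eq_integral_smul hv]
  simp only [smul_eq_mul, gaussianPDFReal_mul_exp_sq hv]
  rw [integral_const_mul, integral_gaussian, ← Real.sqrt_inv, ← Real.sqrt_mul (by positivity)]
  congr 1
  field_simp
  ring

/-- Chernoff bound for the quadratic variation along a mesh. For a Gaussian increment `Z` of variance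
`h`, `Z ^ 2` has exponential moment `√2` at `1 / (4 * h)`. -/
theorem ProbabilityTheory.IsPreBrownianReal.measure_lt_sum_sq_increments_le {Ω : Type*}
    [MeasurableSpace Ω] {P : Measure Ω} {X : ℝ≥0 → Ω → ℝ} [IsProbabilityMeasure P]
    (hX : IsPreBrownianReal X P) (hXm : ∀ s, Measurable (X s)) {h : ℝ≥0} (hh : h ≠ 0) (m : ℕ) :
    P.real {ω | 8 * m * h < ∑ k ∈ Finset.range m, (X ((k + 1 : ℕ) * h) ω - X (k * h) ω) ^ 2} ≤
      Real.exp (-m) := by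
  have hh' : (0 : ℝ) < h := by positivity
  set Y : ℕ → Ω → ℝ := fun k ω => (X ((k + 1 : ℕ) * h) ω - X (k * h) ω) ^ 2 with hY
  have hlaw : ∀ k : ℕ, HasLaw (X ((k + 1 : ℕ) * h) - X (k * h)) (gaussianReal 0 h) P := by
    intro k
    have := hX.hasLaw_sub ((k + 1 : ℕ) * h) (k * h)
    have e : nndist (((k + 1 : ℕ) * h : ℝ≥0) : ℝ) ((k * h : ℝ≥0) : ℝ) = h := by
      rw [← NNReal.coe_inj, coe_nndist, Real.dist_eq]
      push_cast
      rw [show ((k : ℝ) + 1) * h - k * h = h by ring, abs_of_pos hh']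
    convert this using 2
    exact e.symm
  have hind : iIndepFun Y P :=
    (hX.hasIndepIncrements.nat (t := fun k => (k : ℝ≥0) * h)
      (fun i j hij => by dsimp only; gcongr)).comp (fun _ x => x ^ 2) (fun _ => by fun_prop)
  have hYm : ∀ k, Measurable (Y k) := fun k => ((hXm _).sub (hXm _)).pow_const 2
  have hint : ∀ k, Integrable (fun ω => Real.exp (1 / (4 * h) * Y k ω)) P := fun k =>
    ((hlaw k).map_eq ▸ integrable_exp_sq_gaussianReal hh).comp_aemeasurable (hlaw k).aemeasurable
  have hmgf : ∀ k, mgf (Y k) P (1 / (4 * h)) = √2 := by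
    intro k
    rw [← integral_exp_sq_gaussianReal hh, ← (hlaw k).map_eq,
      integral_map (hlaw k).aemeasurable (by fun_prop)]
    rfl
  have h2 : √2 ≤ Real.exp (1 / 2) := by
    rw [Real.sqrt_le_left (by positivity), ← Real.exp_nat_mul]
    norm_num
    linarith [Real.exp_one_gt_d9]
  have hch := measure_ge_le_exp_mul_mgf (μ := P) (X := ∑ k ∈ Finset.range m, Y k) (8 * m * h)
    (t := 1 / (4 * h)) (by positivity) ?_
  · rw [hind.mgf_sum hYm, Finset.prod_congr rfl (fun k _ => hmgf k), Finset.prod_const,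
      Finset.card_range] at hch
    refine (measureReal_mono fun ω hω => ?_).trans (hch.trans ?_)
    · have : 8 * m * h < ∑ k ∈ Finset.range m, Y k ω := hω
      simpa using this.le
    · calc _ ≤ Real.exp (-(1 / (4 * h)) * (8 * m * h)) * Real.exp (1 / 2) ^ m := by gcongr
        _ = Real.exp (-(3 / 2 * m)) := by
          rw [← Real.exp_nat_mul, ← Real.exp_add]
          congr 1
          field_simp
          ring
        _ ≤ _ := by
          refine Real.exp_le_exp.2 ?_
          have : (0 : ℝ) ≤ m := by positivity
          linarith
  · exact hind.integrable_exp_mul_sum hYm fun k _ => hint k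

theorem measure_notMem_tamePaths_le {Ω : Type*} [MeasurableSpace Ω] {P : Measure Ω}
    [IsProbabilityMeasure P] {W : Ω → C(ℝ≥0, ℝ)} (hWm : Measurable W)
    (hW : IsPreBrownianReal (fun (s : ℝ≥0) (ω : Ω) => W ω s) P) {h : ℝ≥0} (hh : h ≠ 0) {δ : ℝ}
    (hδ : 0 ≤ δ) (m : ℕ) :
    P.real {ω | W ω ∉ tamePaths h δ m} ≤
      4 * m * Real.exp (-(δ ^ 2 / (2 * h))) + Real.exp (-m) := by
  have hWs : ∀ s, Measurable fun ω => W ω s := fun s => (continuous_eval_const s).measurable.comp hWm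
  have hsub : {ω | W ω ∉ tamePaths h δ m} ⊆
      (⋃ k ∈ Finset.range m, {ω | ∃ s ≤ h, δ < |W ω (k * h + s) - W ω (k * h)|}) ∪
        {ω | 8 * m * h <
          ∑ k ∈ Finset.range m, (W ω ((k + 1 : ℕ) * h) - W ω (k * h)) ^ 2} := by
    intro ω hω
    by_contra H
    simp only [Set.mem_union, Set.mem_iUnion, Finset.mem_range, Set.mem_ofPred_eq, not_or,
      not_exists, not_and, not_lt] at H
    exact hω ⟨fun k hk s hs => H.1 k hk s hs, H.2⟩
  refine (measureReal_mono hsub).trans ((measureReal_union_le _ _).trans ?_)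
  refine add_le_add ?_ (hW.measure_lt_sum_sq_increments_le hWs hh m)
  refine (measureReal_biUnion_finset_le _ _).trans ?_
  calc _ ≤ ∑ k ∈ Finset.range m, 4 * Real.exp (-(δ ^ 2 / (2 * h))) :=
        Finset.sum_le_sum fun k _ => (hW.shift (k * h)).measure_exists_le_lt_abs_le
          (fun s => (hWs _).sub (hWs _)) (fun ω => by fun_prop) hh hδ
    _ = _ := by simp; ring

/-! ### Conditioning on the environment and measurability -/

theorem isClosed_stripEvent (β a b a' b' : ℝ) (t : ℝ≥0) (x : ℝ) :
    IsClosed (stripEvent β a b a' b' t x) := by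
  have h : ∀ (s : ℝ≥0) (l u : ℝ), IsClosed {p : C(ℝ≥0, ℝ) × C(ℝ≥0, ℝ) |
      β * p.2 s + l ≤ x + p.1 s ∧ x + p.1 s ≤ β * p.2 s + u} := fun s l u => by
    have h1 : Continuous fun p : C(ℝ≥0, ℝ) × C(ℝ≥0, ℝ) => p.1 s :=
      (continuous_eval_const s).comp continuous_fst
    have h2 : Continuous fun p : C(ℝ≥0, ℝ) × C(ℝ≥0, ℝ) => p.2 s :=
      (continuous_eval_const s).comp continuous_snd
    have h3 : IsClosed {p : C(ℝ≥0, ℝ) × C(ℝ≥0, ℝ) | β * p.2 s + l ≤ x + p.1 s} :=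
      isClosed_le (by fun_prop) (by fun_prop)
    have h4 : IsClosed {p : C(ℝ≥0, ℝ) × C(ℝ≥0, ℝ) | x + p.1 s ≤ β * p.2 s + u} :=
      isClosed_le (by fun_prop) (by fun_prop)
    exact h3.inter h4
  have : stripEvent β a b a' b' t x =
      (⋂ (s : ℝ≥0) (_ : s ≤ t), {p | β * p.2 s + a ≤ x + p.1 s ∧ x + p.1 s ≤ β * p.2 s + b}) ∩
      {p | β * p.2 t + a' ≤ x + p.1 t ∧ x + p.1 t ≤ β * p.2 t + b'} := by
    ext p
    simp [stripEvent]
  rw [this]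
  exact (isClosed_iInter fun s => isClosed_iInter fun _ => h s a b).inter (h t a' b')

/-- The measure of the sections of a closed set is upper semicontinuous: sections along a
convergent sequence have their upper limit contained in the limiting section. -/
theorem upperSemicontinuous_measure_section {E F : Type*} [TopologicalSpace E]
    [MeasurableSpace E] [OpensMeasurableSpace E] [TopologicalSpace F] [FirstCountableTopology F]
    (μ : Measure E) [IsFiniteMeasure μ] {S : Set (E × F)} (hS : IsClosed S) :
    UpperSemicontinuous fun y => μ {x | (x, y) ∈ S} := by
  have hmeas : ∀ y, MeasurableSet {x | (x, y) ∈ S} := fun y =>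
    (hS.preimage (f := fun x => (x, y)) (by fun_prop)).measurableSet
  intro y c hc
  by_contra H
  obtain ⟨u, hu, hcu⟩ := exists_seq_forall_of_frequently (not_eventually.1 H)
  have hsub : (⋂ n, ⋃ k ≥ n, {x | (x, u k) ∈ S}) ⊆ {x | (x, y) ∈ S} := by
    intro x hx
    simp only [Set.mem_iInter, Set.mem_iUnion] at hx
    have hfreq : ∃ᶠ k in atTop, (x, u k) ∈ S := frequently_atTop.2 fun n => by
      obtain ⟨k, hk, h⟩ := hx n
      exact ⟨k, hk, h⟩
    exact hS.mem_of_frequently_of_tendsto hfreq (tendsto_const_nhds.prodMk_nhds hu)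
  have hanti : Antitone fun n => ⋃ k ≥ n, {x | (x, u k) ∈ S} := fun n m hnm =>
    Set.biUnion_mono (fun k hk => le_trans hnm hk) fun _ _ => le_rfl
  have hle : c ≤ μ (⋂ n, ⋃ k ≥ n, {x | (x, u k) ∈ S}) := by
    rw [hanti.measure_iInter (fun n => (MeasurableSet.iUnion fun k =>
      MeasurableSet.iUnion fun _ => hmeas _).nullMeasurableSet) ⟨0, measure_ne_top _ _⟩]
    refine le_iInf fun n => (not_lt.1 (hcu n)).trans (measure_mono ?_)
    exact Set.subset_biUnion_of_mem (u := fun k => {x | (x, u k) ∈ S}) (le_refl n)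
  exact absurd hc (not_lt.2 (hle.trans (measure_mono hsub)))

/-- Upper semicontinuity survives arbitrary infima, so that the uncountable infimum over the
starting points is measurable. -/
theorem measurable_iInf_measure_stripEvent (μ : Measure C(ℝ≥0, ℝ)) [IsFiniteMeasure μ]
    (β a b a' b' : ℝ) (t : ℝ≥0) (s : Set ℝ) :
    Measurable fun w => ⨅ x ∈ s, μ {f | (f, w) ∈ stripEvent β a b a' b' t x} :=
  (upperSemicontinuous_biInf fun x _ => upperSemicontinuous_measure_section μ
    (isClosed_stripEvent β a b a' b' t x)).measurable

theorem condDistrib_prodMk_ae_eq_of_indepFun {Ω E F : Type*} [MeasurableSpace Ω]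
    [MeasurableSpace E] [StandardBorelSpace E] [Nonempty E]
    [MeasurableSpace F] [StandardBorelSpace F] [Nonempty F]
    {P : Measure Ω} [IsProbabilityMeasure P] {B : Ω → E} {W : Ω → F}
    (hB : Measurable B) (hW : Measurable W) (h : IndepFun B W P) :
    condDistrib (fun ω => (B ω, W ω)) W P =ᵐ[P.map W]
      (Kernel.const F (P.map B) ×ₖ Kernel.id : Kernel F (E × F)) := by
  have : IsProbabilityMeasure (P.map B) := Measure.isProbabilityMeasure_map hB.aemeasurable
  have : IsProbabilityMeasure (P.map W) := Measure.isProbabilityMeasure_map hW.aemeasurable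
  refine condDistrib_ae_eq_of_measure_eq_compProd_of_measurable hW (hB.prodMk hW) ?_
  have hind := (indepFun_iff_map_prod_eq_prod_map_map hW.aemeasurable hB.aemeasurable).1 h.symm
  have hg : Measurable fun p : F × E => (p.1, p.2, p.1) := by fun_prop
  ext s hs
  rw [Measure.compProd_apply hs]
  calc P.map (fun ω => (W ω, B ω, W ω)) s
      = ((P.map fun ω => (W ω, B ω)).map fun p : F × E => (p.1, p.2, p.1)) s := by
        rw [Measure.map_map hg (hW.prodMk hB)]; rfl
    _ = ∫⁻ w, (P.map B) (Prod.mk w ⁻¹' ((fun p : F × E => (p.1, p.2, p.1)) ⁻¹' s)) ∂P.map W := by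
        rw [Measure.map_apply hg hs, hind, Measure.prod_apply (hg hs)]
    _ = _ := by
        refine lintegral_congr fun w => ?_
        rw [Kernel.prod_apply, Kernel.const_apply, Kernel.id_apply, Measure.prod_dirac,
          Measure.map_apply (by fun_prop) (hs.preimage (by fun_prop))]
        rfl

/-- Given `W`, the path `B` keeps its law. The exceptional null set does not depend on the starting
point `x`. -/
theorem quenchedProb_ae_eq {Ω : Type*} [MeasurableSpace Ω] {P : Measure Ω}
    [IsProbabilityMeasure P] {B W : Ω → C(ℝ≥0, ℝ)} (hB : Measurable B) (hW : Measurable W)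
    (h : IndepFun B W P) (β a b a' b' : ℝ) (t : ℝ≥0) :
    ∀ᵐ ω ∂P, ∀ x, quenchedProb P B W β a b a' b' t x ω =
      P.map B {f | (f, W ω) ∈ stripEvent β a b a' b' t x} := by
  have : IsProbabilityMeasure (P.map B) := Measure.isProbabilityMeasure_map hB.aemeasurable
  filter_upwards [ae_of_ae_map hW.aemeasurable (condDistrib_prodMk_ae_eq_of_indepFun hB hW h)]
    with ω hω x
  rw [quenchedProb, hω, Kernel.prod_apply, Kernel.const_apply, Kernel.id_apply, Measure.prod_dirac,
    Measure.map_apply (by fun_prop) (isClosed_stripEvent β a b a' b' t x).measurableSet]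
  rfl

/-! ### Consequences of an exponential tail -/

section

theorem tendsto_exp_mul_sub_rpow {p q c : ℝ} (hq : 1 < q) (hc : 0 < c) :
    Tendsto (fun x : ℝ => Real.exp (p * x - c * x ^ q)) atTop (𝓝 0) := by
  refine Real.tendsto_exp_atBot.comp ?_
  have h1 : Tendsto (fun x : ℝ => x * (p - c * x ^ (q - 1))) atTop atBot := by
    refine tendsto_id.atTop_mul_atBot₀ ?_
    simp_rw [sub_eq_add_neg]
    exact tendsto_atBot_add_const_left _ _ (tendsto_neg_atTop_atBot.comp
      ((tendsto_rpow_atTop (by linarith)).const_mul_atTop hc))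
  refine h1.congr' ?_
  filter_upwards [eventually_gt_atTop 0] with x hx
  rw [mul_sub, show x * (c * x ^ (q - 1)) = c * (x ^ (q - 1) * x ^ (1 : ℝ)) by
    rw [Real.rpow_one]; ring, ← Real.rpow_add hx]
  ring_nf

variable {Ω : Type*} [MeasurableSpace Ω] {P : Measure Ω} [IsProbabilityMeasure P] {Y : Ω → EReal}
  {K c C : ℝ}

/-- An exponential tail along the multiples of `K` beats every power of `n` at the level
`(log n) ^ q`, `q > 1`. -/
theorem tendsto_rpow_mul_measure_log_rpow_le (hK : 0 < K) (hc : 0 < c)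
    (hY : ∀ m : ℕ, P.real {ω | ((K * m : ℝ) : EReal) < Y ω} ≤ C * Real.exp (-(c * m)))
    (p : ℝ) {q : ℝ} (hq : 1 < q) :
    Tendsto (fun n : ℕ => (n : ℝ) ^ p * P.real {ω | ((Real.log n ^ q : ℝ) : EReal) ≤ Y ω})
      atTop (𝓝 0) := by
  have hC : 0 ≤ C := by
    have := measureReal_nonneg.trans (hY 0)
    simpa using this
  have hlim := ((tendsto_exp_mul_sub_rpow (p := p) hq (c := c / (2 * K)) (by positivity)).comp
    (Real.tendsto_log_atTop.comp tendsto_natCast_atTop_atTop)).const_mul (C * Real.exp c)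
  rw [mul_zero] at hlim
  refine squeeze_zero' (Eventually.of_forall fun n => by positivity) ?_ hlim
  filter_upwards [eventually_ge_atTop 2] with n hn
  have hn' : (0 : ℝ) < n := by positivity
  have hL : 0 < Real.log n := Real.log_pos (by exact_mod_cast hn)
  set L := Real.log n with hLdef
  have hLq : 0 < L ^ q := Real.rpow_pos_of_pos hL q
  -- `K * m` lies strictly below the level `L ^ q`, but is comparable with it.
  set m := ⌊L ^ q / (2 * K)⌋₊ with hm
  have hm1 : (m : ℝ) ≤ L ^ q / (2 * K) := Nat.floor_le (by positivity)
  have hm2 : L ^ q / (2 * K) - 1 ≤ m := (Nat.sub_one_lt_floor _).le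
  have hKm : K * m < L ^ q := by
    calc K * m ≤ K * (L ^ q / (2 * K)) := by gcongr
      _ = L ^ q / 2 := by field_simp
      _ < L ^ q := by linarith
  have h1 : P.real {ω | ((L ^ q : ℝ) : EReal) ≤ Y ω} ≤
      C * Real.exp (c - c / (2 * K) * L ^ q) := by
    refine (measureReal_mono fun ω hω => ?_).trans ((hY m).trans ?_)
    · exact (EReal.coe_lt_coe_iff.2 hKm).trans_le hω
    · gcongr
      have : c / (2 * K) * L ^ q = c * (L ^ q / (2 * K)) := by ring
      rw [this]
      nlinarith
  calc (n : ℝ) ^ p * P.real {ω | ((L ^ q : ℝ) : EReal) ≤ Y ω}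
      ≤ Real.exp (L * p) * (C * Real.exp (c - c / (2 * K) * L ^ q)) := by
        rw [Real.rpow_def_of_pos hn']
        gcongr
    _ = C * Real.exp c * Real.exp (p * L - c / (2 * K) * L ^ q) := by
        rw [mul_left_comm, mul_assoc, ← Real.exp_add, ← Real.exp_add]
        ring_nf

theorem lintegral_toENNReal_pow_lt_top (hK : 0 < K) (hc : 0 < c) (hYm : AEMeasurable Y P)
    (hY : ∀ m : ℕ, P.real {ω | ((K * m : ℝ) : EReal) < Y ω} ≤ C * Real.exp (-(c * m))) (j : ℕ) :
    ∫⁻ ω, (Y ω).toENNReal ^ j ∂P < ⊤ := by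
  set A : ℕ → Set Ω := fun m => {ω | ((K * m : ℝ) : EReal) < Y ω} with hA
  have hAm : ∀ m, NullMeasurableSet (A m) P := fun m => hYm.nullMeasurable measurableSet_Ioi
  have hr0 : 0 < Real.exp (-c) := Real.exp_pos _
  have hr1 : Real.exp (-c) < 1 := Real.exp_zero ▸ Real.exp_lt_exp.2 (by linarith)
  have hexp : ∀ m : ℕ, Real.exp (-(c * m)) = Real.exp (-c) ^ m := fun m => by
    rw [← Real.exp_nat_mul]; ring_nf
  have htop : ∀ᵐ ω ∂P, Y ω ≠ ⊤ := by
    have h1 : P.real {ω | Y ω = ⊤} ≤ 0 := by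
      have hlim : Tendsto (fun m : ℕ => C * Real.exp (-c) ^ m) atTop (𝓝 0) := by
        simpa using (tendsto_pow_atTop_nhds_zero_of_lt_one hr0.le hr1).const_mul C
      refine ge_of_tendsto' hlim fun m => ?_
      rw [← hexp]
      refine (measureReal_mono fun ω hω => ?_).trans (hY m)
      have hω : Y ω = ⊤ := hω
      show _ < Y ω
      rw [hω]
      exact EReal.coe_lt_top _
    have h2 := le_antisymm h1 measureReal_nonneg
    rw [measureReal_eq_zero_iff] at h2
    simpa [ae_iff] using h2
  -- The summand `1` is needed for `j = 0` where `Y ω ≤ 0`, as `0 ^ 0 = 1`.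
  have hbound : ∀ᵐ ω ∂P, (Y ω).toENNReal ^ j ≤
      1 + ∑' m : ℕ, (A m).indicator (fun _ => ENNReal.ofReal ((K * (m + 1)) ^ j)) ω := by
    filter_upwards [htop] with ω hω
    rcases le_or_gt (Y ω) 0 with h | h
    · rw [EReal.toENNReal_of_nonpos h]
      exact (pow_le_one₀ zero_le zero_le_one).trans le_self_add
    · obtain ⟨y, hy⟩ : ∃ y : ℝ, Y ω = y :=
        ⟨(Y ω).toReal, (EReal.coe_toReal hω (ne_bot_of_gt h)).symm⟩
      have hy0 : 0 < y := by rw [hy] at h; exact_mod_cast h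
      -- `m + 1 = ⌈y / K⌉`, so that `K * m < y ≤ K * (m + 1)`
      obtain ⟨m, hm⟩ := Nat.exists_eq_succ_of_ne_zero (Nat.ceil_pos.2 (div_pos hy0 hK)).ne'
      have h1 : y ≤ K * (m + 1) := by
        have := Nat.le_ceil (y / K)
        rw [hm, div_le_iff₀ hK] at this
        push_cast at this
        linarith
      have h2 : K * m < y := by
        have := (Nat.lt_ceil (n := m) (a := y / K)).1 (by omega)
        rw [lt_div_iff₀ hK] at this
        linarith
      have hmem : ω ∈ A m := by
        show _ < Y ω
        rw [hy]
        exact_mod_cast h2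
      refine le_trans ?_ ((ENNReal.le_tsum m).trans le_add_self)
      rw [Set.indicator_of_mem hmem, hy, EReal.toENNReal_of_ne_top (EReal.coe_ne_top y),
        EReal.toReal_coe, ← ENNReal.ofReal_pow hy0.le]
      gcongr
  refine (lintegral_mono_ae hbound).trans_lt ?_
  rw [lintegral_add_left measurable_const, lintegral_tsum fun m =>
    aemeasurable_const.indicator₀ (hAm m)]
  refine ENNReal.add_lt_top.2 ⟨by simp, ?_⟩
  have hsummable : Summable fun m : ℕ => (K * (m + 1)) ^ j * (C * Real.exp (-c) ^ m) := by
    have h1 := summable_pow_mul_geometric_of_norm_lt_one (R := ℝ) j (r := Real.exp (-c))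
      (by rwa [Real.norm_of_nonneg hr0.le])
    have h2 := ((summable_nat_add_iff 1).2 h1).mul_left (K ^ j * C * (Real.exp (-c))⁻¹)
    refine h2.congr fun m => ?_
    push_cast
    rw [mul_pow, pow_succ]
    field_simp
  refine (ENNReal.tsum_le_tsum fun m => ?_).trans_lt hsummable.tsum_ofReal_lt_top
  rw [lintegral_indicator_const₀ (hAm m), ENNReal.ofReal_mul (by positivity), ← ofReal_measureReal]
  gcongr
  rw [← hexp]
  exact hY m

end

/-! ### The exponential tail of the quenched probability -/

/-- The exponential tail: outside the event that `W` is tame on the mesh of `m` intervals, which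
has exponentially small probability, `upperX` is at most `K * m`. -/
theorem exists_measure_lt_upperX_le {Ω : Type*} [MeasurableSpace Ω] {P : Measure Ω}
    [IsProbabilityMeasure P]
    {B W : Ω → C(ℝ≥0, ℝ)} (hBm : Measurable B) (hWm : Measurable W)
    (hB : IsPreBrownianReal (fun (s : ℝ≥0) (ω : Ω) => B ω s) P)
    (hW : IsPreBrownianReal (fun (s : ℝ≥0) (ω : Ω) => W ω s) P)
    (hBW : IndepFun B W P)
    {β a b a₀ b₀ a' b' : ℝ} (hβ : 0 < β)
    (h₁ : a < a₀) (h₃ : b₀ < b) (h₄ : a ≤ a') (h₅ : a' < b') (h₆ : b' ≤ b)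
    {t : ℝ≥0} (ht : 0 < t) :
    ∃ K c C : ℝ, 0 < K ∧ 0 < c ∧ ∀ m : ℕ,
      P.real {ω | ((K * m : ℝ) : EReal) < upperX P B W β a b a₀ b₀ a' b' t ω} ≤
        C * Real.exp (-(c * m)) := by
  have ht' : (0 : ℝ) < t := ht
  obtain ⟨η, hη₀, hη₁, hη₂, hη₃⟩ :
      ∃ η : ℝ, 0 < η ∧ η ≤ a₀ - a ∧ η ≤ b - b₀ ∧ η ≤ (b' - a') / 2 :=
    ⟨min (min (a₀ - a) (b - b₀)) ((b' - a') / 2),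
      lt_min (lt_min (by linarith) (by linarith)) (by linarith),
      (min_le_left _ _).trans (min_le_left _ _), (min_le_left _ _).trans (min_le_right _ _),
      min_le_right _ _⟩
  set δ := η / (8 * β) with hδ
  have hδ₀ : 0 < δ := by positivity
  set γ := δ ^ 2 / (4 * t) with hγ
  have hγ₀ : 0 < γ := by positivity
  set K := 16 * β ^ 2 + 2 * (b - a) ^ 2 / t + 3 with hK
  obtain ⟨M, hM⟩ := exists_nat_ge (max (64 * t / η ^ 2) (8 * (b - a) / η))
  have hM₁ := (le_max_left _ _).trans hM
  have hM₂ := (le_max_right _ _).trans hM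
  rw [div_le_iff₀ (by positivity)] at hM₁ hM₂
  set c := min γ 1 with hc
  have hc₀ : 0 < c := lt_min hγ₀ one_pos
  refine ⟨K, c, 4 / γ + 1 + Real.exp (c * (M + 1)), by positivity, hc₀, fun m => ?_⟩
  rcases lt_or_ge m (M + 1) with hm | hm
  · -- for small `m` the bound exceeds `1`
    refine measureReal_le_one.trans ?_
    have h1 : Real.exp (c * m) ≤ Real.exp (c * (M + 1)) := by
      gcongr
      exact_mod_cast hm.le
    have h2 : Real.exp (c * m) * Real.exp (-(c * m)) = 1 := by
      rw [← Real.exp_add, add_neg_cancel, Real.exp_zero]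
    have h3 := Real.exp_pos (-(c * m))
    have h4 : 0 ≤ 4 / γ + 1 := by positivity
    nlinarith
  have hm0 : m ≠ 0 := by omega
  have hmM : (M : ℝ) ≤ m := by exact_mod_cast (by omega : M ≤ m)
  have hm' : (0 : ℝ) < m := by positivity
  have hh0 : t / m ≠ 0 := by positivity
  have hae : {ω | ((K * m : ℝ) : EReal) < upperX P B W β a b a₀ b₀ a' b' t ω} ≤ᵐ[P]
      {ω | W ω ∉ tamePaths (t / m) δ m} := by
    filter_upwards [quenchedProb_ae_eq hBm hWm hBW β a b a' b' t, hW.eval_zero_ae_eq_zero]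
      with ω hω hω₀ hlt htame
    have hlt : ((K * m : ℝ) : EReal) < upperX P B W β a b a₀ b₀ a' b' t ω := hlt
    refine absurd hlt (not_lt.2 ?_)
    have hinf : ENNReal.ofReal (Real.exp (-(K * m))) ≤
        ⨅ x ∈ Set.Icc a₀ b₀, quenchedProb P B W β a b a' b' t x ω := by
      refine le_iInf₂ fun x hx => ?_
      have hS : MeasurableSet {f | (f, W ω) ∈ stripEvent β a b a' b' t x} :=
        ((isClosed_stripEvent β a b a' b' t x).preimage
          (f := fun f : C(ℝ≥0, ℝ) => (f, W ω)) (by fun_prop)).measurableSet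
      rw [hω x, Measure.map_apply hBm hS]
      have := exp_le_measure_stripEvent hBm hB (a := a) (b := b) (a' := a') (b' := b')
        (x := x) ht.ne' hm0 hβ (by linarith [hx.1])
        (by linarith [hx.2]) (by linarith) (by linarith) hη₃ hη₀ (by nlinarith [sq_nonneg η])
        (by nlinarith) hω₀ htame
      exact (ENNReal.ofReal_le_iff_le_toReal (measure_ne_top _ _)).2 this
    have hlog := ENNReal.log_monotone hinf
    rw [ENNReal.log_ofReal_of_pos (Real.exp_pos _), Real.log_exp] at hlog
    rw [upperX, EReal.neg_le]
    exact_mod_cast hlog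
  have hmono : P.real {ω | ((K * m : ℝ) : EReal) < upperX P B W β a b a₀ b₀ a' b' t ω} ≤
      P.real {ω | W ω ∉ tamePaths (t / m) δ m} :=
    ENNReal.toReal_mono (measure_ne_top _ _) (measure_mono_ae hae)
  refine hmono.trans ((measure_notMem_tamePaths_le hWm hW hh0 hδ₀.le m).trans ?_)
  have e1 : δ ^ 2 / (2 * ((t / m : ℝ≥0) : ℝ)) = γ * m + γ * m := by
    push_cast
    rw [hγ]
    field_simp
    ring
  have e2 : m * Real.exp (-(γ * m + γ * m)) ≤ 1 / γ * Real.exp (-(c * m)) := by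
    have i1 : γ * m ≤ Real.exp (γ * m) := by linarith [Real.add_one_le_exp (γ * m)]
    have i2 : Real.exp (-(γ * m)) ≤ Real.exp (-(c * m)) := by
      gcongr
      exact min_le_left _ _
    calc m * Real.exp (-(γ * m + γ * m))
        = 1 / γ * (γ * m * Real.exp (-(γ * m))) * Real.exp (-(γ * m)) := by
          rw [neg_add, Real.exp_add]; field_simp
      _ ≤ 1 / γ * (Real.exp (γ * m) * Real.exp (-(γ * m))) * Real.exp (-(c * m)) := by gcongr
      _ = _ := by rw [← Real.exp_add, add_neg_cancel, Real.exp_zero, mul_one]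
  have e3 : Real.exp (-m) ≤ Real.exp (-(c * m)) := by
    refine Real.exp_le_exp.2 ?_
    have : c ≤ 1 := min_le_right _ _
    nlinarith
  have e4 : 0 ≤ Real.exp (c * (M + 1)) * Real.exp (-(c * m)) := by positivity
  have e5 : (4 / γ + 1 + Real.exp (c * (M + 1))) * Real.exp (-(c * m)) =
      4 * (1 / γ * Real.exp (-(c * m))) + Real.exp (-(c * m)) +
        Real.exp (c * (M + 1)) * Real.exp (-(c * m)) := by ring
  rw [e1, e5]
  linarith

theorem aemeasurable_upperX {Ω : Type*} [MeasurableSpace Ω] {P : Measure Ω}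
    [IsProbabilityMeasure P] {B W : Ω → C(ℝ≥0, ℝ)} (hBm : Measurable B) (hWm : Measurable W)
    (hBW : IndepFun B W P) (β a b a₀ b₀ a' b' : ℝ) (t : ℝ≥0) :
    AEMeasurable (upperX P B W β a b a₀ b₀ a' b' t) P := by
  have : IsProbabilityMeasure (P.map B) := Measure.isProbabilityMeasure_map hBm.aemeasurable
  refine ⟨fun ω => -ENNReal.log (⨅ x ∈ Set.Icc a₀ b₀,
    P.map B {f | (f, W ω) ∈ stripEvent β a b a' b' t x}), ?_, ?_⟩
  · exact (((measurable_iInf_measure_stripEvent (P.map B) β a b a' b' t (Set.Icc a₀ b₀)).comp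
      hWm).ennreal_log).neg
  · filter_upwards [quenchedProb_ae_eq hBm hWm hBW β a b a' b' t] with ω hω
    simp only [upperX, hω]

theorem theorem3p1 {Ω : Type*} [MeasurableSpace Ω] (P : Measure Ω) [IsProbabilityMeasure P]
    (B W : Ω → C(ℝ≥0, ℝ)) (hBm : Measurable B) (hWm : Measurable W)
    (hB : IsBrownianReal (fun (s : ℝ≥0) (ω : Ω) => B ω s) P)
    (hW : IsBrownianReal (fun (s : ℝ≥0) (ω : Ω) => W ω s) P)
    (hBW : IndepFun B W P)
    (β a b a₀ b₀ a' b' : ℝ) (hβ : 0 < β)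
    (h₁ : a < a₀) (h₂ : a₀ ≤ b₀) (h₃ : b₀ < b)
    (h₄ : a ≤ a') (h₅ : a' < b') (h₆ : b' ≤ b)
    (t : ℝ≥0) (ht : 0 < t) :
    AEMeasurable (upperX P B W β a b a₀ b₀ a' b' t) P ∧
    (∀ p q : ℝ, 0 < p → 1 < q →
      Tendsto (fun n : ℕ => (n : ℝ) ^ p *
          P.real {ω | (((Real.log n) ^ q : ℝ) : EReal) ≤ upperX P B W β a b a₀ b₀ a' b' t ω})
        atTop (𝓝 0)) ∧
    (∀ j : ℕ, ∫⁻ ω, (upperX P B W β a b a₀ b₀ a' b' t ω).toENNReal ^ j ∂P < ⊤) := by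
  have hmeas := aemeasurable_upperX hBm hWm hBW β a b a₀ b₀ a' b' t
  obtain ⟨K, c, C, hK, hc, htail⟩ := exists_measure_lt_upperX_le hBm hWm hB.toIsPreBrownianReal
    hW.toIsPreBrownianReal hBW hβ h₁ h₃ h₄ h₅ h₆ ht
  exact ⟨hmeas, fun p q _ hq => tendsto_rpow_mul_measure_log_rpow_le hK hc htail p hq,
    fun j => lintegral_toENNReal_pow_lt_top hK hc hmeas htail j⟩
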